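/- Let $F=\langle x,y\rangle$ be the free group of rank two. An element $w(x,y)\in F$ is palindromic if $w(x^{-1},y^{-1})=w(x,y)^{-1}$, and an automorphism of $F$ is palindromic if it takes palindromic elements to palindromic elements. Let $\phi$ be a palindromic automorphism of $F$ (for example $\phi(x)=xyx$, $\phi(y)=x$), let $n\ge 1$ be an integer, and let $$G=F\rtimes_{\phi^n}\langle t\rangle=\langle x,y,t\mid txt^{-1}=\phi^n(x),\ tyt^{-1}=\phi^n(y)\rangle .$$ Let $\tau_F$, $\tau_G$ be the involutions of $F$ and $G$ given by $x\mapsto x^{-1}$, $y\mapsto y^{-1}$ and, for $G$, $t\mapsto t$. Let $T$ be a finite tree of valence at most $3$, with $|T|$ vertices. Assign to each vertex its own triple of indices, cyclically ordered; for an index $i$, let $i+1$ denote the next index in its triple. For each index $i$ take copies $F_i\subset G_i$ of $F\subset G$, with generators $x_i,y_i,t_i$. A vertex with triple $(i,i+1,i+2)$ is given the groups $V=F_i\times F_{i+1}\times F_{i+2}$ and $W=G_i\times G_{i+1}\times G_{i+2}$. The peripheral subgroups are $A_i=\langle a_i,b_i\rangle\le V$ and $B_i=\langle a_i,b_i,c_i\rangle\le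 W$, where $a_i=x_i^{-1}x_{i+1}$, $b_i=y_i^{-1}y_{i+1}$, $c_i=t_it_{i+1}$; they are identified with $F$ and $G$ through these generators. At each vertex assign distinct indices of its triple to the outgoing edges. Let $V_T$ (resp. $W_T$) be the group obtained from the free product of the groups $V$ (resp. $W$) over all vertices by amalgamating, for each edge of $T$ with assigned indices $i$ and $j$ at its two ends, $A_i$ with $A_j$ via $\tau_F$ (resp. $B_i$ with $B_j$ via $\tau_G$). That is, one imposes $a_i=a_j^{-1}$, $b_i=b_j^{-1}$ (and $c_i=c_j$ for $W_T$). There remain $|T|+2$ indices not assigned to edges. Put $m=|T|+1$ and enumerate these indices, in any order, as $\nu_0,\dots,\nu_m$. Define $$S_{T,n}=\langle V_T,r_1,\dots,r_m\mid r_ia_{\nu_0}r_i^{-1}=\phi^n(a_{\nu_i}),\ r_ib_{\nu_0}r_i^{-1}=\phi^n(b_{\nu_i})\ (1\le i\le m)\rangle,$$ $$G_{T,n}=\langle W_T,s_1,\dots,s_m\mid s_ia_{\nu_0}s_i^{-1}=a_{\nu_i},\ s_ib_{\nu_0}s_i^{-1}=b_{\nu_i},\ s_ic_{\nu_0}s_i^{-1}=c_{\nu_i}\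 (1\le i\le m)\rangle,$$ where $\phi^n$ is applied in $A_{\nu_i}=\langle a_{\nu_i},b_{\nu_i}\rangle\cong F$, and let $u_i=c_{\nu_i}s_i\in G_{T,n}$. Theorem. The inclusions $F_i\hookrightarrow G_i$ induce a (unique) homomorphism $V_T\to W_T$, and it is injective. This homomorphism together with the assignment $r_i\mapsto u_i$ ($1\le i\le m$) induces a (unique) homomorphism $S_{T,n}\to G_{T,n}$, and it is injective. -/

import Mathlib

namespace Snowflake

/-- The free group `F = ⟨x, y⟩` of rank two; `x` is `FreeGroup.of 0`, `y` is `FreeGroup.of 1`. -/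
abbrev F : Type := FreeGroup (Fin 2)

/-- The endomorphism `x ↦ x⁻¹`, `y ↦ y⁻¹` of `F`. -/
def tauHom : F →* F := FreeGroup.lift fun i => (FreeGroup.of i)⁻¹

theorem tauHom_comp_tauHom : tauHom.comp tauHom = MonoidHom.id F := by
  ext i
  simp [tauHom]

/-- The involution `τ_F` of `F`, as an automorphism. -/
def tauF : MulAut F :=
  MonoidHom.toMulEquiv tauHom tauHom tauHom_comp_tauHom tauHom_comp_tauHom

@[simp] theorem tauF_of (i : Fin 2) : tauF (FreeGroup.of i) = (FreeGroup.of i)⁻¹ := by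
  simp [tauF, tauHom]

/-- `w(x, y)` is palindromic if `w(x⁻¹, y⁻¹) = w(x, y)⁻¹` in `F`. -/
def IsPalindrome (w : F) : Prop := tauF w = w⁻¹

/-- An automorphism of `F` is palindromic if it takes palindromic words to palindromic words. -/
def IsPalindromicAut (φ : MulAut F) : Prop := ∀ w : F, IsPalindrome w → IsPalindrome (φ w)

theorem IsPalindromicAut.commute {φ : MulAut F} (hφ : IsPalindromicAut φ) : Commute tauF φ := by
  have h : (tauF * φ).toMonoidHom = (φ * tauF).toMonoidHom := by
    ext i
    have := hφ (FreeGroup.of i) (tauF_of i)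
    simpa [IsPalindrome] using this
  exact MulEquiv.ext fun w => DFunLike.congr_fun h w

/-- The concrete automorphism `x ↦ x y x`, `y ↦ x`, with inverse `x ↦ y`, `y ↦ y⁻¹ x y⁻¹`. -/
def stdAut : MulAut F :=
  MonoidHom.toMulEquiv
    (FreeGroup.lift ![FreeGroup.of 0 * FreeGroup.of 1 * FreeGroup.of 0, FreeGroup.of 0])
    (FreeGroup.lift ![FreeGroup.of 1, (FreeGroup.of 1)⁻¹ * FreeGroup.of 0 * (FreeGroup.of 1)⁻¹])
    (by ext i; fin_cases i <;> simp [mul_assoc])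
    (by ext i; fin_cases i <;> simp [mul_assoc])

/-- The concrete automorphism is palindromic, so it is one of those considered below. -/
theorem stdAut_isPalindromicAut : IsPalindromicAut stdAut := by
  have h : (tauF * stdAut).toMonoidHom = (stdAut * tauF).toMonoidHom := by
    ext i
    fin_cases i <;> simp [stdAut, mul_assoc]
  intro w hw
  have hc : tauF (stdAut w) = stdAut (tauF w) := DFunLike.congr_fun h w
  unfold IsPalindrome at hw ⊢
  rw [hc, hw, map_inv]

/-- The free-by-cyclic group `G = F ⋊_{φⁿ} ⟨t⟩`, in which `t w t⁻¹ = φⁿ(w)` for `w ∈ F`. -/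
abbrev FbyZ (φ : MulAut F) (n : ℕ) : Type :=
  F ⋊[zpowersHom (MulAut F) (φ ^ n)] Multiplicative ℤ

/-- The inclusion `F ↪ G`. -/
def inclF (φ : MulAut F) (n : ℕ) : F →* FbyZ φ n := SemidirectProduct.inl

/-- The generator `t` of `G`. -/
def genT (φ : MulAut F) (n : ℕ) : FbyZ φ n := SemidirectProduct.inr (Multiplicative.ofAdd 1)

/-- The involution `τ_G` of `G`: it is `τ_F` on `F` and fixes `t`. -/
def tauG {φ : MulAut F} (hφ : IsPalindromicAut φ) (n : ℕ) : FbyZ φ n →* FbyZ φ n :=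
  SemidirectProduct.map tauF.toMonoidHom (MonoidHom.id _) (by
    intro g
    have h : Commute tauF ((φ ^ n) ^ (Multiplicative.toAdd g)) :=
      (hφ.commute.pow_right n).zpow_right _
    ext i
    exact DFunLike.congr_fun h.eq (FreeGroup.of i))

/-- For a group `H` with endomorphism `τ`, the homomorphism `τ × id : H → H_k × H_{k+1}` into
`H_0 × H_1 × H_2` (indices mod 3). For `H = F` and `H = G` its image is the peripheral subgroup
`A_k`, respectively `B_k`, with its identification with `F`, respectively `G`. -/
def periph {H : Type*} [Group H] (τ : H →* H) (k : Fin 3) : H →* (Fin 3 → H) :=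
  MonoidHom.pi fun j => if j = k then τ else if j = k + 1 then MonoidHom.id H else 1

/-- An assignment of distinct peripheral subgroups (numbered by `Fin 3`) to the outgoing edges at
each vertex of `T`. It exists exactly when all valences are at most `3`. -/
structure Labelling {Q : Type*} (T : SimpleGraph Q) where
  label : T.Dart → Fin 3
  distinct : ∀ d e : T.Dart, d.fst = e.fst → label d = label e → d = e

/-- The index `(v, k)` belongs to the boundary if the `k`-th peripheral subgroup at `v` is not
assigned to an edge of `T`. -/
def Labelling.IsBoundary {Q : Type*} {T : SimpleGraph Q} (L : Labelling T) (i : Q × Fin 3) : Prop :=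
  ∀ d : T.Dart, d.fst = i.1 → L.label d ≠ i.2

section TreeAmalgam

variable {Q : Type*} {T : SimpleGraph Q} (L : Labelling T) {H : Type*} [Group H] (τ : H →* H)

/-- The relators which, for every edge of `T`, identify the two peripheral subgroups assigned to
it via `τ`. -/
def treeRelators : Set (Monoid.CoprodI fun _ : Q => (Fin 3 → H)) :=
  {g | ∃ (d : T.Dart) (h : H),
    g = Monoid.CoprodI.of (i := d.fst) (periph τ (L.label d) h) *
      (Monoid.CoprodI.of (i := d.snd) (periph τ (L.label d.symm) (τ h)))⁻¹}

/-- The amalgam over `T` of copies of `H_0 × H_1 × H_2`, one for each vertex. -/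
def TreeAmalgam : Type _ :=
  (Monoid.CoprodI fun _ : Q => (Fin 3 → H)) ⧸ Subgroup.normalClosure (treeRelators L τ)

instance : Group (TreeAmalgam L τ) :=
  inferInstanceAs (Group (_ ⧸ Subgroup.normalClosure (treeRelators L τ)))

/-- The canonical map from the vertex group at `v`. -/
def TreeAmalgam.of (v : Q) : (Fin 3 → H) →* TreeAmalgam L τ :=
  (QuotientGroup.mk' (Subgroup.normalClosure (treeRelators L τ))).comp (Monoid.CoprodI.of (M := fun _ : Q => (Fin 3 → H)) (i := v))

/-- The canonical map from `H` onto the peripheral subgroup with index `i = (v, k)`. -/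
def TreeAmalgam.periph (i : Q × Fin 3) : H →* TreeAmalgam L τ :=
  (TreeAmalgam.of L τ i.1).comp (Snowflake.periph τ i.2)

end TreeAmalgam

section HNN

variable {K E J : Type*} [Group K] [Group E] (α : E →* K) (β : J → E →* K)

/-- The relators `r_j α(e) r_j⁻¹ = β_j(e)`. -/
def hnnRelators : Set (Monoid.Coprod K (FreeGroup J)) :=
  {g | ∃ (j : J) (e : E),
    g = Monoid.Coprod.inr (FreeGroup.of j) * Monoid.Coprod.inl (α e) *
      (Monoid.Coprod.inr (FreeGroup.of j))⁻¹ * (Monoid.Coprod.inl (β j e))⁻¹}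

/-- The multiple HNN extension `⟨K, r_j (j ∈ J) | r_j α(e) r_j⁻¹ = β_j(e) for all e ∈ E, j ∈ J⟩`. -/
def MultiHNN : Type _ :=
  Monoid.Coprod K (FreeGroup J) ⧸ Subgroup.normalClosure (hnnRelators α β)

instance : Group (MultiHNN α β) :=
  inferInstanceAs (Group (_ ⧸ Subgroup.normalClosure (hnnRelators α β)))

/-- The canonical map from the base group. -/
def MultiHNN.of : K →* MultiHNN α β :=
  (QuotientGroup.mk' (Subgroup.normalClosure (hnnRelators α β))).comp Monoid.Coprod.inl

/-- The stable letters. -/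
def MultiHNN.stable (j : J) : MultiHNN α β :=
  QuotientGroup.mk' (Subgroup.normalClosure (hnnRelators α β))
    (Monoid.Coprod.inr (FreeGroup.of j))

end HNN

section Groups

variable {Q : Type*} [Fintype Q] {T : SimpleGraph Q} (L : Labelling T)

/-- The group `V_T`. -/
abbrev VT : Type _ := TreeAmalgam L tauF.toMonoidHom

/-- The group `W_T`. -/
abbrev WT {φ : MulAut F} (hφ : IsPalindromicAut φ) (n : ℕ) : Type _ := TreeAmalgam L (tauG hφ n)

/-- The group `S_{T,n}`, with stable letters `r_1, …, r_m`, where `m = |T| + 1`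
and `r_{i+1}` is `stable i`. -/
abbrev ST (ν : Fin (Fintype.card Q + 2) ≃ {i : Q × Fin 3 // L.IsBoundary i})
    (φ : MulAut F) (n : ℕ) : Type _ :=
  MultiHNN (J := Fin (Fintype.card Q + 1))
    (TreeAmalgam.periph L tauF.toMonoidHom (ν 0))
    (fun i => (TreeAmalgam.periph L tauF.toMonoidHom (ν i.succ)).comp (φ ^ n).toMonoidHom)

/-- The group `G_{T,n}`, with (untwisted) stable letters `s_1, …, s_m`, where `m = |T| + 1`
and `s_{i+1}` is `stable i`. -/
abbrev GT (ν : Fin (Fintype.card Q + 2) ≃ {i : Q × Fin 3 // L.IsBoundary i})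
    {φ : MulAut F} (hφ : IsPalindromicAut φ) (n : ℕ) : Type _ :=
  MultiHNN (J := Fin (Fintype.card Q + 1))
    (TreeAmalgam.periph L (tauG hφ n) (ν 0))
    (fun i => TreeAmalgam.periph L (tauG hφ n) (ν i.succ))

/-- The twisted stable letters `u_i = c_{ν_i} s_i` of `G_{T,n}`, where `c_j` is the generator of
the peripheral subgroup `B_j` corresponding to `t`. -/
def twistedStable (ν : Fin (Fintype.card Q + 2) ≃ {i : Q × Fin 3 // L.IsBoundary i})
    {φ : MulAut F} (hφ : IsPalindromicAut φ) (n : ℕ) (i : Fin (Fintype.card Q + 1)) :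
    GT L ν hφ n :=
  MultiHNN.of _ _ (TreeAmalgam.periph L (tauG hφ n) (ν i.succ) (genT φ n)) *
    MultiHNN.stable _ _ i

end Groups

end Snowflake

/-!
The proof uses permutation representations instead of normal forms. To see that a homomorphism
`Γ → Δ` is injective, it suffices to extend the left translation action of `Γ` on itself to an
action of `Δ` on a larger set `X ⊇ Γ`. Since `Δ` is one of the groups `W_T`, `G_{T,n}` given by a
presentation, such an action amounts to actions of the vertex groups `W` which agree along the edges
of `T`, and permutations for the stable letters.

The gluing rests on `IsFreeExtension.exists_intertwiner`. Let `A ≤ B` be groups, and let `B` act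
freely on `X ⊇ Y` in such a way that exactly the elements of `A` move points of `Y` into `Y`. Up to
isomorphism relative to `Y`, such an action is determined by the action of `A` on `Y` and the number
of orbits disjoint from `Y`, and this number can be made as large as `X` itself. Here `A = F`,
`B = G`, and the condition says that a peripheral subgroup `B_i` of `W` meets `V` in `A_i`, which
holds because a coordinate of `W` restricts to an isomorphism `B_i → G`
(`mem_range_of_periph_mem_range`).

A free action of `V` on `Y` extends to a free action of `W` on a set depending only on the set `Y`
(`exists_isFreeExtension`). For an action of `V_T` on `Y` with free vertex groups, the extensions at
the two ends of an edge can be matched relative to `Y`, and over a tree these matchings can be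
composed consistently (`exists_potential`); this gives an action of `W_T`
(`exists_treeAmalgam_extension`). The stable letter `s_i` has to conjugate the action of `B_{ν_0}`
to that of `B_{ν_i}` and to agree with `c_{ν_i}⁻¹ r_i` on `Y = S_{T,n}`; since `t` normalizes `F` and
acts on it as `φⁿ`, the same gluing lemma provides it (`MultiHNN.exists_extension`).

That the vertex groups act freely by translations on `S_{T,n}`, that is, embed in it, is obtained by
the same construction with `A = B = F` and `Y` empty (`vertexGroup_eq_one_of_map_eq_one`).
-/

namespace Snowflake

open Equiv

universe u

/-! ### Multiplicative potentials on trees -/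

/-- On a tree every family of group elements attached to the edges is the coboundary of a function
on the vertices. The edge elements are prescribed only up to a relation `R`, so that no orientation
of the edges has to be chosen. -/
theorem exists_potential {Q P : Type*} [Group P] {T : SimpleGraph Q} (hT : T.IsTree)
    (R : T.Dart → P → Prop) (hR : ∀ d, ∃ p, R d p) (hsymm : ∀ d p, R d p → R d.symm p⁻¹) :
    ∃ f : Q → P, ∀ d : T.Dart, R d ((f d.fst)⁻¹ * f d.snd) := by
  classical
  choose c hc using hR
  obtain ⟨r⟩ := hT.connected.nonempty
  choose path hpath hunique using fun v => hT.existsUnique_path r v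
  refine ⟨fun v => ((path v).darts.map c).prod, fun d => ?_⟩
  by_cases hw : d.snd ∈ (path d.fst).support
  · -- The path to `d.fst` runs through `d.snd`, so it ends with the dart `d.symm`.
    have h1 : (path d.fst).takeUntil d.snd hw = path d.snd :=
      hunique _ _ ((hpath _).takeUntil hw)
    have h2 : (path d.fst).dropUntil d.snd hw = SimpleGraph.Walk.cons d.adj.symm .nil :=
      (hT.existsUnique_path _ _).unique ((hpath _).dropUntil hw)
        (by simp [SimpleGraph.Walk.isPath_def, d.adj.ne'])
    have h3 : path d.fst = (path d.snd).append (SimpleGraph.Walk.cons d.adj.symm .nil) := by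
      rw [← h1, ← h2, SimpleGraph.Walk.take_spec]
    have h4 : ((path d.fst).darts.map c).prod =
        ((path d.snd).darts.map c).prod * c d.symm := by
      rw [h3]
      simp [SimpleGraph.Walk.darts_append]
      rfl
    have h5 := hsymm _ _ (hc d.symm)
    rw [SimpleGraph.Dart.symm_symm] at h5
    simpa [h4] using h5
  · have h3 : (path d.fst).concat d.adj = path d.snd :=
      hunique _ _ ((hpath _).concat hw d.adj)
    have h4 : ((path d.snd).darts.map c).prod =
        ((path d.fst).darts.map c).prod * c d := by
      rw [← h3]
      simp [SimpleGraph.Walk.darts_concat]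
    simpa [h4] using hc d

/-! ### Free actions extending a partial action -/

/-- Two surjections onto `X` with the same fibres differ by a permutation of `X`. -/
theorem exists_perm_of_same_fibres {Z X : Type*} {m₁ m₂ : Z → X} (h₁ : Function.Surjective m₁)
    (h₂ : Function.Surjective m₂) (h : ∀ p q, m₁ p = m₁ q ↔ m₂ p = m₂ q) :
    ∃ e : Perm X, ∀ p, e (m₁ p) = m₂ p := by
  choose s₁ hs₁ using h₁
  choose s₂ hs₂ using h₂
  refine ⟨⟨fun x => m₂ (s₁ x), fun x => m₁ (s₂ x), fun x => ?_, fun x => ?_⟩, fun p => ?_⟩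
  · change m₁ (s₂ (m₂ (s₁ x))) = x
    rw [(h _ (s₁ x)).2 (hs₂ _), hs₁]
  · change m₂ (s₁ (m₁ (s₂ x))) = x
    rw [(h _ (s₂ x)).1 (hs₁ _), hs₂]
  · exact (h _ _).1 (hs₁ _)

theorem inv_mul_apply_eq {B X : Type*} [Group B] (ρ : B →* Perm X) {b b' : B} {x x' : X}
    (h : ρ b x = ρ b' x') : ρ (b'⁻¹ * b) x = x' := by
  simp [h]

/-- `ρ` is a free action of `B` on `X`, and `j` embeds `Y` in `X` in such a way that an element of
`B` which moves some point of `Y` into `Y` lies in the image of `A`. Moreover, `X` is large: there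
are as many orbits disjoint from `Y` as there are points of `X`. -/
structure IsFreeExtension {A B Y X : Type*} [Group A] [Group B] (ι : A →* B) (ρ : B →* Perm X)
    (j : Y → X) : Prop where
  free : ∀ b x, ρ b x = x → b = 1
  injective : Function.Injective j
  mem_range : ∀ b y y', ρ b (j y) = j y' → b ∈ ι.range
  large : ∃ k : X → X, (∀ b x x', ρ b (k x) = k x' → x = x') ∧ ∀ b x y, ρ b (k x) ≠ j y

namespace IsFreeExtension

variable {A B Y X : Type*} [Group A] [Group B] {ι : A →* B} {ρ ρ₁ ρ₂ : B →* Perm X}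
  {j j₁ j₂ : Y → X}

/-- The orbits disjoint from `Y` can be enumerated by `X` itself, by the Schröder–Bernstein
theorem. -/
theorem exists_transversal (h : IsFreeExtension ι ρ j) :
    ∃ k : X → X, (∀ b x x', ρ b (k x) = k x' → x = x') ∧ (∀ b x y, ρ b (k x) ≠ j y) ∧
      ∀ x, ∃ b, (∃ y, ρ b (j y) = x) ∨ ∃ x', ρ b (k x') = x := by
  obtain ⟨k, hk, hkj⟩ := h.large
  let s : Setoid X :=
    { r := fun x x' => ∃ b, ρ b x = x'
      iseqv := ⟨fun x => ⟨1, by simp⟩, fun {x x'} ⟨b, hb⟩ => ⟨b⁻¹, by simp [← hb]⟩,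
        fun {x x' x''} ⟨b, hb⟩ ⟨b', hb'⟩ => ⟨b' * b, by simp [hb, hb']⟩⟩ }
  let C : Set (Quotient s) := {q | ∀ y, (⟦j y⟧ : Quotient s) ≠ q}
  let f : X ↪ C := ⟨fun x => ⟨⟦k x⟧, fun y hy => by
      obtain ⟨b, hb⟩ := Quotient.exact hy.symm
      exact hkj b x y hb⟩, fun x x' hxx' => by
      obtain ⟨b, hb⟩ := Quotient.exact (Subtype.ext_iff.1 hxx')
      exact hk b x x' hb⟩
  let g : C ↪ X := ⟨fun q => q.1.out, fun q q' hqq' => Subtype.ext (Quotient.out_injective hqq')⟩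
  obtain ⟨e⟩ := Function.Embedding.antisymm f g
  refine ⟨fun x => (e x).1.out, fun b x x' hb => ?_, fun b x y hb => ?_, fun x => ?_⟩
  · apply e.injective
    apply Subtype.ext
    rw [← Quotient.out_eq (e x).1, ← Quotient.out_eq (e x').1]
    exact Quotient.sound ⟨b, hb⟩
  · apply (e x).2 y
    rw [← Quotient.out_eq (e x).1]
    exact (Quotient.sound ⟨b, hb⟩ : (⟦(e x).1.out⟧ : Quotient s) = ⟦j y⟧).symm
  · by_cases hx : (⟦x⟧ : Quotient s) ∈ C
    · obtain ⟨b, hb⟩ := Quotient.exact (Quotient.out_eq (⟦x⟧ : Quotient s))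
      exact ⟨b, Or.inr ⟨e.symm ⟨_, hx⟩, by simpa using hb⟩⟩
    · obtain ⟨y, hy⟩ : ∃ y, (⟦j y⟧ : Quotient s) = ⟦x⟧ := by simpa [C] using hx
      obtain ⟨b, hb⟩ := Quotient.exact hy
      exact ⟨b, Or.inl ⟨y, hb⟩⟩

/-- The points of `X`, parametrized by group elements and orbit representatives; the
representatives for the orbits meeting `Y` are all the points of `Y`. -/
def orbitMap (ρ : B →* Perm X) (j : Y → X) (k : X → X) (p : B × (Y ⊕ X)) : X :=
  ρ p.1 (Sum.elim j k p.2)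

/-- The coincidences of `orbitMap` on the orbits of `Y` are dictated by the action of `A`
on `Y`. -/
theorem orbitMap_eq_imp (h₁ : IsFreeExtension ι ρ₁ j₁)
    (σ : A → Y → Y) (hσ₁ : ∀ a y, ρ₁ (ι a) (j₁ y) = j₁ (σ a y))
    (hσ₂ : ∀ a y, ρ₂ (ι a) (j₂ y) = j₂ (σ a y)) {k₁ k₂ : X → X}
    (hk : ∀ b x x', ρ₁ b (k₁ x) = k₁ x' → x = x') (hkj : ∀ b x y, ρ₁ b (k₁ x) ≠ j₁ y)
    {p q : B × (Y ⊕ X)} (hpq : orbitMap ρ₁ j₁ k₁ p = orbitMap ρ₁ j₁ k₁ q) :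
    orbitMap ρ₂ j₂ k₂ p = orbitMap ρ₂ j₂ k₂ q := by
  obtain ⟨b, y | x⟩ := p <;> obtain ⟨b', y' | x'⟩ := q <;>
    simp only [orbitMap, Sum.elim_inl, Sum.elim_inr] at hpq ⊢
  · have h := inv_mul_apply_eq ρ₁ hpq
    obtain ⟨a, ha⟩ := h₁.mem_range _ _ _ h
    rw [← ha, hσ₁] at h
    rw [← h₁.injective h, ← hσ₂, ha]
    simp
  · exact (hkj _ _ _ (inv_mul_apply_eq ρ₁ hpq.symm)).elim
  · exact (hkj _ _ _ (inv_mul_apply_eq ρ₁ hpq)).elim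
  · have h := inv_mul_apply_eq ρ₁ hpq
    obtain rfl := hk _ _ _ h
    rw [← inv_mul_eq_one.1 (h₁.free _ _ h)]

/-- Two free extensions of the same action of `A` on `Y` are isomorphic relative to `Y`. -/
theorem exists_intertwiner (h₁ : IsFreeExtension ι ρ₁ j₁) (h₂ : IsFreeExtension ι ρ₂ j₂)
    (σ : A → Y → Y) (hσ₁ : ∀ a y, ρ₁ (ι a) (j₁ y) = j₁ (σ a y))
    (hσ₂ : ∀ a y, ρ₂ (ι a) (j₂ y) = j₂ (σ a y)) :
    ∃ e : Perm X, (∀ y, e (j₁ y) = j₂ y) ∧ ∀ b, e * ρ₁ b = ρ₂ b * e := by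
  obtain ⟨k₁, hk₁, hkj₁, hs₁⟩ := h₁.exists_transversal
  obtain ⟨k₂, hk₂, hkj₂, hs₂⟩ := h₂.exists_transversal
  have surj : ∀ {ρ : B →* Perm X} {j : Y → X} {k : X → X},
      (∀ x, ∃ b, (∃ y, ρ b (j y) = x) ∨ ∃ x', ρ b (k x') = x) →
      Function.Surjective (orbitMap ρ j k) := by
    intro ρ j k hs x
    obtain ⟨b, ⟨y, hy⟩ | ⟨x', hx'⟩⟩ := hs x
    · exact ⟨(b, Sum.inl y), hy⟩
    · exact ⟨(b, Sum.inr x'), hx'⟩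
  obtain ⟨e, he⟩ := exists_perm_of_same_fibres (surj hs₁) (surj hs₂) fun p q =>
    ⟨h₁.orbitMap_eq_imp σ hσ₁ hσ₂ hk₁ hkj₁, h₂.orbitMap_eq_imp σ hσ₂ hσ₁ hk₂ hkj₂⟩
  refine ⟨e, fun y => by simpa [orbitMap] using he (1, Sum.inl y), fun b => ?_⟩
  ext x
  obtain ⟨⟨b', z⟩, rfl⟩ := surj hs₁ x
  have h := he (b * b', z)
  simp only [Perm.mul_apply, he]
  simpa [orbitMap] using h

/-- Transport of a free extension along a permutation of the large set. -/
theorem conj (h : IsFreeExtension ι ρ j) (f : Perm X) :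
    IsFreeExtension ι ((MulAut.conj f).toMonoidHom.comp ρ) (f ∘ j) where
  free b x hb := h.free b (f⁻¹ x) (by
    rw [Perm.eq_inv_iff_eq]
    simpa using hb)
  injective := f.injective.comp h.injective
  mem_range b y y' hb := h.mem_range b y y' (f.injective (by simpa using hb))
  large := by
    obtain ⟨k, hk, hkj⟩ := h.large
    refine ⟨fun x => f (k x), fun b x x' hb => hk b x x' (f.injective (by simpa using hb)),
      fun b x y hb => hkj b x y (f.injective (by simpa using hb))⟩

/-- Restriction of a free extension along an injective homomorphism `θ`. -/
theorem comp {A' B' : Type*} [Group A'] [Group B'] (h : IsFreeExtension ι ρ j) {ι' : A' →* B'}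
    (θ : B' →* B) (hinj : Function.Injective θ) (hθ : ∀ b, θ b ∈ ι.range → b ∈ ι'.range) :
    IsFreeExtension ι' (ρ.comp θ) j where
  free b x hb := hinj (by rw [h.free _ x hb, map_one])
  injective := h.injective
  mem_range b y y' hb := hθ b (h.mem_range _ _ _ hb)
  large := by
    obtain ⟨k, hk, hkj⟩ := h.large
    exact ⟨k, fun b => hk _, fun b x y => hkj _ x _⟩

/-- The embedding of `Y` may be changed by a permutation of `Y` and by the action of an element
of `B`. -/
theorem translate (h : IsFreeExtension ι ρ j) (hι : ι.range.Normal) (c : B) (s : Perm Y) :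
    IsFreeExtension ι ρ fun y => ρ c (j (s y)) where
  free := h.free
  injective := (ρ c).injective.comp (h.injective.comp s.injective)
  mem_range b y y' hb := by
    rw [← Perm.mul_apply, ← map_mul] at hb
    have := hι.conj_mem _ (h.mem_range _ _ _ (inv_mul_apply_eq ρ hb)) c
    simpa [mul_assoc] using this
  large := by
    obtain ⟨k, hk, hkj⟩ := h.large
    exact ⟨k, hk, fun b x y hb => hkj _ x _ (inv_mul_apply_eq ρ hb)⟩

end IsFreeExtension

/-- A free action of `V` on `Y` is the left translation action on a part of `V × Y`. -/
theorem exists_trivialization {V Y : Type*} [Group V] (α : V →* Perm Y)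
    (hα : ∀ v y, α v y = y → v = 1) :
    ∃ j : Y → V × Y, Function.Injective j ∧
      ∀ v y, j (α v y) = (v * (j y).1, (j y).2) := by
  let s : Setoid Y :=
    { r := fun x x' => ∃ b, α b x = x'
      iseqv := ⟨fun x => ⟨1, by simp⟩, fun {x x'} ⟨b, hb⟩ => ⟨b⁻¹, by simp [← hb]⟩,
        fun {x x' x''} ⟨b, hb⟩ ⟨b', hb'⟩ => ⟨b' * b, by simp [hb, hb']⟩⟩ }
  have key : ∀ y : Y, ∃ v, α v (⟦y⟧ : Quotient s).out = y := fun y =>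
    Quotient.exact (Quotient.out_eq (⟦y⟧ : Quotient s))
  choose c hc using key
  refine ⟨fun y => (c y, (⟦y⟧ : Quotient s).out), fun y y' h => ?_, fun v y => ?_⟩
  · obtain ⟨h1, h2⟩ := Prod.mk.inj h
    rw [← hc y, ← hc y', h1, h2]
  · have hq : (⟦α v y⟧ : Quotient s) = ⟦y⟧ := Quotient.sound ⟨v⁻¹, by simp⟩
    refine Prod.ext ?_ (by simp only [hq])
    have h : α (c (α v y)) (⟦y⟧ : Quotient s).out = α (v * c y) (⟦y⟧ : Quotient s).out := by
      rw [map_mul, Perm.mul_apply, hc y, ← hq, hc]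
    exact (inv_mul_eq_one.1 (hα _ _ (inv_mul_apply_eq α h))).symm

/-- The left translation action of `W` on a disjoint union of copies of `W` indexed by `I`. -/
def leftTranslation (W I : Type*) [Group W] : W →* Perm (W × I) where
  toFun w := (Equiv.mulLeft w).prodCongr (Equiv.refl I)
  map_one' := by ext <;> simp
  map_mul' w w' := by ext <;> simp [mul_assoc]

@[simp] theorem leftTranslation_apply {W I : Type*} [Group W] (w : W) (p : W × I) :
    leftTranslation W I w p = (w * p.1, p.2) := rfl

/-- An index set for copies of `W`: besides one copy for each point of `Y`, there are as many further
copies as `W × CopyIndex W Y` has elements. Lists serve to make this set equinumerous with the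
resulting union of copies of `W`. -/
abbrev CopyIndex (W Y : Type*) : Type _ := Y ⊕ List (Y ⊕ W)

/-- A free action of a subgroup `V` of `W` extends to a free action of `W`, on a set which depends
only on `W` and on the underlying set of the action of `V`. -/
theorem exists_isFreeExtension {V W Y : Type*} [Group V] [Group W] (ι : V →* W)
    (hι : Function.Injective ι) (α : V →* Perm Y) (hα : ∀ v y, α v y = y → v = 1) :
    ∃ j : Y → W × CopyIndex W Y,
      IsFreeExtension ι (leftTranslation W (CopyIndex W Y)) j ∧
        ∀ v y, leftTranslation W (CopyIndex W Y) (ι v) (j y) = j (α v y) := by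
  obtain ⟨j, hj, hjα⟩ := exists_trivialization α hα
  -- The first list entry tells the two kinds of copies apart.
  let enc : W × CopyIndex W Y → List (Y ⊕ W) := fun p =>
    p.2.elim (fun y => [Sum.inl y, Sum.inr p.1]) fun l => Sum.inr p.1 :: l
  have henc : Function.Injective enc := by
    rintro ⟨w, y | l⟩ ⟨w', y' | l'⟩ h <;> simp_all [enc]
  refine ⟨fun y => (ι (j y).1, Sum.inl (j y).2), ⟨fun b x hb => ?_, fun y y' h => ?_,
    fun b y y' h => ?_, fun x => (1, Sum.inr (enc x)), fun b x x' h => ?_, fun b x y h => ?_⟩,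
    fun v y => ?_⟩
  · simpa using congrArg Prod.fst hb
  · obtain ⟨h1, h2⟩ := Prod.mk.inj h
    exact hj (Prod.ext (hι h1) (Sum.inl_injective h2))
  · refine ⟨(j y').1 * (j y).1⁻¹, ?_⟩
    have : b * ι (j y).1 = ι (j y').1 := congrArg Prod.fst h
    rw [map_mul, map_inv, ← this, mul_inv_cancel_right]
  · exact henc (Sum.inr_injective (congrArg Prod.snd h))
  · exact Sum.inr_ne_inl (congrArg Prod.snd h)
  · simp [hjα]

/-- The elements of `K` for which `j` intertwines the actions `a` and `b`. -/
def equivariantSubgroup {K Y X : Type*} [Group K] (a : K →* Perm Y) (b : K →* Perm X) (j : Y → X) :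
    Subgroup K where
  carrier := {g | ∀ y, b g (j y) = j (a g y)}
  one_mem' := by simp
  mul_mem' hg hh y := by simp only [map_mul, Perm.mul_apply, hh y, hg _]
  inv_mem' {g} hg y := by
    rw [map_inv, Perm.inv_eq_iff_eq, hg, ← Perm.mul_apply, ← map_mul, mul_inv_cancel, map_one,
      Perm.one_apply]

/-! ### Amalgams over trees -/

namespace TreeAmalgam

variable {Q : Type*} {T : SimpleGraph Q} (L : Labelling T) {H : Type*} [Group H] (τ : H →* H)

theorem of_periph (d : T.Dart) (h : H) :
    of L τ d.fst (Snowflake.periph τ (L.label d) h) =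
      of L τ d.snd (Snowflake.periph τ (L.label d.symm) (τ h)) := by
  rw [← mul_inv_eq_one]
  exact (QuotientGroup.eq_one_iff _).2 (Subgroup.subset_normalClosure ⟨d, h, rfl⟩)

theorem subgroup_eq_top {S : Subgroup (TreeAmalgam L τ)} (hS : ∀ v w, of L τ v w ∈ S) : S = ⊤ := by
  refine (Subgroup.eq_top_iff' S).2 fun g => ?_
  obtain ⟨g, rfl⟩ := QuotientGroup.mk_surjective g
  induction g using Monoid.CoprodI.induction_on with
  | one => exact S.one_mem
  | of v w => exact hS v w
  | mul x y hx hy => exact S.mul_mem hx hy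

variable {L τ}

/-- The universal property of the amalgam. -/
theorem exists_lift {P : Type*} [Group P] (f : Q → (Fin 3 → H) →* P)
    (hf : ∀ (d : T.Dart) (h : H), f d.fst (Snowflake.periph τ (L.label d) h) =
      f d.snd (Snowflake.periph τ (L.label d.symm) (τ h))) :
    ∃ g : TreeAmalgam L τ →* P, ∀ v w, g (of L τ v w) = f v w := by
  refine ⟨QuotientGroup.lift _ (Monoid.CoprodI.lift f) fun x hx => ?_, fun v w => ?_⟩
  · refine Subgroup.normalClosure_le_normal (N := (Monoid.CoprodI.lift f).ker) ?_ hx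
    rintro _ ⟨d, h, rfl⟩
    change Monoid.CoprodI.lift f _ = 1
    rw [map_mul, map_inv, Monoid.CoprodI.lift_of, Monoid.CoprodI.lift_of, hf, mul_inv_cancel]
  · exact Monoid.CoprodI.lift_of f w

end TreeAmalgam

theorem periph_apply_self {H : Type*} [Group H] (τ : H →* H) (k : Fin 3) (h : H) :
    periph τ k h (k + 1) = h := by
  simp [periph]

theorem periph_injective {H : Type*} [Group H] (τ : H →* H) (k : Fin 3) :
    Function.Injective (periph τ k) := fun h h' hh => by
  rw [← periph_apply_self τ k h, hh, periph_apply_self]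

theorem periph_comp {A H : Type*} [Group A] [Group H] {τ' : A →* A} {τ : H →* H} {ι : A →* H}
    (hι : ∀ a, ι (τ' a) = τ (ι a)) (k : Fin 3) (a : A) :
    periph τ k (ι a) = ι.compLeft (Fin 3) (periph τ' k a) := by
  funext l
  simp only [periph, MonoidHom.pi_apply, MonoidHom.compLeft_apply, Function.comp_apply]
  split_ifs <;> simp [hι]

theorem mem_range_of_periph_mem_range {A H : Type*} [Group A] [Group H] {τ : H →* H} {ι : A →* H}
    {k : Fin 3} {h : H} (hh : periph τ k h ∈ (ι.compLeft (Fin 3)).range) : h ∈ ι.range := by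
  obtain ⟨x, hx⟩ := hh
  exact ⟨x (k + 1), by rw [← periph_apply_self τ k h, ← hx]; rfl⟩

theorem IsFreeExtension.comp_periph {A H Y X : Type*} [Group A] [Group H] {ι : A →* H}
    {ρ : (Fin 3 → H) →* Perm X} {j : Y → X} (h : IsFreeExtension (ι.compLeft (Fin 3)) ρ j)
    (τ : H →* H) (k : Fin 3) : IsFreeExtension ι (ρ.comp (periph τ k)) j :=
  h.comp _ (periph_injective τ k) fun _ => mem_range_of_periph_mem_range

/-- An action of the smaller tree amalgam in which the vertex groups act freely extends to an action
of the larger one. -/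
theorem exists_treeAmalgam_extension {Q : Type*} {T : SimpleGraph Q} (hT : T.IsTree)
    (L : Labelling T) {A H Y : Type*} [Group A] [Group H] {τ' : A →* A} {τ : H →* H} {ι : A →* H}
    (hinj : Function.Injective ι) (hι : ∀ a, ι (τ' a) = τ (ι a)) (hτ : ∀ h, τ (τ h) = h)
    (α : TreeAmalgam L τ' →* Perm Y)
    (hα : ∀ v x y, α (TreeAmalgam.of L τ' v x) y = y → x = 1) :
    ∃ (ρ : TreeAmalgam L τ →* Perm ((Fin 3 → H) × CopyIndex (Fin 3 → H) Y))
      (j : Y → (Fin 3 → H) × CopyIndex (Fin 3 → H) Y),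
      (∀ v, IsFreeExtension (ι.compLeft (Fin 3)) (ρ.comp (TreeAmalgam.of L τ v)) j) ∧
      ∀ v x y, ρ (TreeAmalgam.of L τ v (ι.compLeft (Fin 3) x)) (j y) =
        j (α (TreeAmalgam.of L τ' v x) y) := by
  set lam := leftTranslation (Fin 3 → H) (CopyIndex (Fin 3 → H) Y)
  choose j hj hjα using fun v => exists_isFreeExtension (ι.compLeft (Fin 3))
    (fun x x' h => funext fun k => hinj (congrFun h k)) (α.comp (TreeAmalgam.of L τ' v)) (hα v)
  -- Along each edge, the actions of the two vertex groups are matched relative to `Y`.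
  obtain ⟨f, hf⟩ := exists_potential hT (P := Perm ((Fin 3 → H) × CopyIndex (Fin 3 → H) Y))
    (fun d e => (∀ y, e (j d.snd y) = j d.fst y) ∧
      ∀ h, e * lam (periph τ (L.label d.symm) (τ h)) = lam (periph τ (L.label d) h) * e)
    (fun d => by
      have hτinj : Function.Injective τ := Function.LeftInverse.injective hτ
      have h1 : IsFreeExtension ι ((lam.comp (periph τ (L.label d.symm))).comp τ) (j d.snd) :=
        ((hj d.snd).comp_periph τ (L.label d.symm)).comp τ hτinj fun b hb => by
          obtain ⟨a, ha⟩ := hb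
          exact ⟨τ' a, by rw [hι, ha, hτ]⟩
      have h2 := (hj d.fst).comp_periph τ (L.label d)
      refine h1.exists_intertwiner h2
        (fun a y => α (TreeAmalgam.of L τ' d.fst (periph τ' (L.label d) a)) y)
        (fun a y => ?_) fun a y => ?_
      · simp only [MonoidHom.comp_apply, ← hι, periph_comp hι]
        rw [hjα, MonoidHom.comp_apply, TreeAmalgam.of_periph]
      · simp only [MonoidHom.comp_apply, periph_comp hι]
        rw [hjα, MonoidHom.comp_apply])
    (fun d e ⟨he, hc⟩ => ⟨fun y => by
        rw [Perm.inv_eq_iff_eq]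
        exact (he y).symm,
      fun h => by
        have := hc (τ h)
        rw [hτ] at this
        rw [SimpleGraph.Dart.symm_symm, inv_mul_eq_iff_eq_mul, ← mul_assoc, this,
          mul_inv_cancel_right]⟩)
  have hadj : ∀ d : T.Dart, f d.snd ∘ j d.snd = f d.fst ∘ j d.fst := fun d => funext fun y => by
    have := (hf d).1 y
    rw [Perm.mul_apply, Perm.inv_eq_iff_eq] at this
    exact this
  -- After conjugation by `f`, all vertex groups act on one set with one embedding of `Y`.
  obtain ⟨r⟩ := hT.connected.nonempty
  have hr : ∀ v, f v ∘ j v = f r ∘ j r := fun v => by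
    obtain ⟨p⟩ := hT.connected.preconnected v r
    induction p with
    | nil => rfl
    | cons h p ih => exact (hadj ⟨(_, _), h⟩).symm.trans ih
  obtain ⟨ρ, hρ⟩ := TreeAmalgam.exists_lift (L := L) (τ := τ)
    (fun v => (MulAut.conj (f v)).toMonoidHom.comp lam) (fun d h => by
      have := (hf d).2 h
      simp only [MonoidHom.comp_apply, MulEquiv.coe_toMonoidHom, MulAut.conj_apply]
      rw [mul_assoc, inv_mul_eq_iff_eq_mul] at this
      rw [this]
      group)
  refine ⟨ρ, f r ∘ j r, fun v => ?_, fun v x y => ?_⟩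
  · rw [show ρ.comp (TreeAmalgam.of L τ v) = (MulAut.conj (f v)).toMonoidHom.comp lam from
      MonoidHom.ext (hρ v), ← hr v]
    exact (hj v).conj (f v)
  · rw [← hr v, hρ]
    have := hjα v x y
    simp only [MonoidHom.comp_apply, MulEquiv.coe_toMonoidHom, MulAut.conj_apply, Perm.mul_apply,
      Function.comp_apply] at this ⊢
    rw [← this, Perm.inv_eq_iff_eq.2 rfl]

/-! ### Multiple HNN extensions -/

namespace MultiHNN

variable {K E J : Type*} [Group K] [Group E] (α : E →* K) (β : J → E →* K)

theorem stable_conj_of (i : J) (e : E) :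
    stable α β i * of α β (α e) * (stable α β i)⁻¹ = of α β (β i e) := by
  rw [← mul_inv_eq_one]
  exact (QuotientGroup.eq_one_iff _).2 (Subgroup.subset_normalClosure ⟨i, e, rfl⟩)

theorem subgroup_eq_top {S : Subgroup (MultiHNN α β)} (hof : ∀ g, of α β g ∈ S)
    (hstable : ∀ i, stable α β i ∈ S) : S = ⊤ := by
  refine (Subgroup.eq_top_iff' S).2 fun g => ?_
  obtain ⟨g, rfl⟩ := QuotientGroup.mk_surjective g
  induction g using Monoid.Coprod.induction_on with
  | inl g => exact hof g
  | inr w =>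
    induction w using FreeGroup.induction_on with
    | C1 => exact (map_one (Monoid.Coprod.inr (M := K) (N := FreeGroup J))).symm ▸ S.one_mem
    | of i => exact hstable i
    | inv_of i _ =>
      exact (map_inv (Monoid.Coprod.inr (M := K) (N := FreeGroup J)) _).symm ▸
        S.inv_mem (hstable i)
    | mul x y hx hy =>
      exact (map_mul (Monoid.Coprod.inr (M := K) (N := FreeGroup J)) _ _).symm ▸ S.mul_mem hx hy
  | mul x y hx hy => exact S.mul_mem hx hy

variable {α β}

/-- The universal property of the multiple HNN extension. -/
theorem exists_lift {P : Type*} [Group P] (f : K →* P) (s : J → P)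
    (hs : ∀ i e, s i * f (α e) = f (β i e) * s i) :
    ∃ g : MultiHNN α β →* P, (∀ x, g (of α β x) = f x) ∧ ∀ i, g (stable α β i) = s i := by
  let Φ : Monoid.Coprod K (FreeGroup J) →* P := Monoid.Coprod.lift f (FreeGroup.lift s)
  refine ⟨QuotientGroup.lift _ Φ fun x hx => ?_, fun x => ?_, fun i => ?_⟩
  · refine Subgroup.normalClosure_le_normal (N := Φ.ker) ?_ hx
    rintro _ ⟨i, e, rfl⟩
    change Φ _ = 1
    simp [Φ, hs]
  · change Φ (Monoid.Coprod.inl x) = f x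
    simp [Φ]
  · change Φ (Monoid.Coprod.inr (FreeGroup.of i)) = s i
    simp [Φ]

/-- An action of the base group extends to the multiple HNN extension, with prescribed values of the
stable letters on `Y`. -/
theorem exists_extension {A Y X : Type*} [Group A] {ι : A →* E} (ρ : K →* Perm X) {j : Y → X}
    {j' : J → Y → X} (h : IsFreeExtension ι (ρ.comp α) j)
    (h' : ∀ i, IsFreeExtension ι (ρ.comp (β i)) (j' i)) (σ : A → Y → Y)
    (hσ : ∀ a y, ρ (α (ι a)) (j y) = j (σ a y))
    (hσ' : ∀ i a y, ρ (β i (ι a)) (j' i y) = j' i (σ a y)) :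
    ∃ ρ' : MultiHNN α β →* Perm X, (∀ x, ρ' (of α β x) = ρ x) ∧
      ∀ i y, ρ' (stable α β i) (j y) = j' i y := by
  choose e he hec using fun i => h.exists_intertwiner (h' i) σ hσ (hσ' i)
  obtain ⟨ρ', h1, h2⟩ := exists_lift ρ e hec
  exact ⟨ρ', h1, fun i y => by rw [h2, he]⟩

end MultiHNN

/-! ### The snowflake groups -/

section

variable {φ : MulAut F} (hφ : IsPalindromicAut φ) (n : ℕ)

theorem tauF_tauF (w : F) : tauF.toMonoidHom (tauF.toMonoidHom w) = w :=
  DFunLike.congr_fun tauHom_comp_tauHom w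

theorem tauG_tauG (g : FbyZ φ n) : tauG hφ n (tauG hφ n g) = g :=
  SemidirectProduct.ext (tauF_tauF g.left) rfl

theorem inclF_injective : Function.Injective (inclF φ n) := SemidirectProduct.inl_injective

theorem inclF_tauF (w : F) : inclF φ n (tauF.toMonoidHom w) = tauG hφ n (inclF φ n w) := by
  rw [inclF, tauG, SemidirectProduct.map_inl]

theorem inclF_range_normal : (inclF φ n).range.Normal := by
  rw [inclF, SemidirectProduct.range_inl_eq_ker_rightHom]
  infer_instance

theorem genT_mul_inclF (w : F) : genT φ n * inclF φ n w = inclF φ n ((φ ^ n) w) * genT φ n := by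
  have := SemidirectProduct.inl_aut (φ := zpowersHom (MulAut F) (φ ^ n)) (Multiplicative.ofAdd 1) w
  rw [map_inv, eq_mul_inv_iff_mul_eq] at this
  rw [genT, inclF, ← this]
  simp

end

section

variable {Q : Type*} {T : SimpleGraph Q}

/-- The vertex groups embed in `S_{T,n}`, because `S_{T,n}` acts on some set with free vertex
groups: no compatibility with a smaller action is required, so the empty one is extended. -/
theorem vertexGroup_eq_one_of_map_eq_one [Fintype Q] (hT : T.IsTree) (L : Labelling T)
    (ν : Fin (Fintype.card Q + 2) ≃ {i : Q × Fin 3 // L.IsBoundary i}) (φ : MulAut F) (n : ℕ)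
    (v : Q) (x : Fin 3 → F)
    (hx : (MultiHNN.of _ _ (TreeAmalgam.of L tauF.toMonoidHom v x) : ST L ν φ n) = 1) : x = 1 := by
  obtain ⟨ρ, j, hρ, -⟩ := exists_treeAmalgam_extension hT L (Y := PEmpty.{1}) (ι := MonoidHom.id F)
    (τ' := tauF.toMonoidHom) (τ := tauF.toMonoidHom) Function.injective_id (fun _ => rfl) tauF_tauF
    1 (fun _ _ y => y.elim)
  have hb (i : Q × Fin 3) :
      IsFreeExtension (MonoidHom.id F) (ρ.comp (TreeAmalgam.periph L tauF.toMonoidHom i)) j :=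
    (hρ i.1).comp_periph _ i.2
  obtain ⟨ρ', hρ', -⟩ := MultiHNN.exists_extension
    (β := fun i : Fin (Fintype.card Q + 1) =>
      (TreeAmalgam.periph L tauF.toMonoidHom (ν i.succ)).comp (φ ^ n).toMonoidHom)
    (j' := fun _ => j) ρ (hb (ν 0))
    (fun i => (hb (ν i.succ)).comp _ (φ ^ n).injective fun b _ => ⟨b, rfl⟩)
    (fun _ y => y) (fun _ y => y.elim) (fun _ _ y => y.elim)
  refine (hρ v).free x (1, Sum.inr []) ?_
  rw [MonoidHom.comp_apply, ← hρ', hx, map_one, Perm.one_apply]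

variable (L : Labelling T) {φ : MulAut F} (hφ : IsPalindromicAut φ) (n : ℕ)

theorem exists_hom_VT_WT : ∃ ι : VT L →* WT L hφ n, ∀ (v : Q) (w : Fin 3 → F),
    ι (TreeAmalgam.of L _ v w) = TreeAmalgam.of L _ v (fun k => inclF φ n (w k)) :=
  TreeAmalgam.exists_lift
    (fun v => (TreeAmalgam.of L (tauG hφ n) v).comp ((inclF φ n).compLeft (Fin 3))) fun d w => by
      simp only [MonoidHom.comp_apply, ← periph_comp (inclF_tauF hφ n)]
      rw [TreeAmalgam.of_periph, inclF_tauF]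

variable {L hφ n}

theorem map_periph {ι : VT L →* WT L hφ n} (hι : ∀ (v : Q) (w : Fin 3 → F),
      ι (TreeAmalgam.of L _ v w) = TreeAmalgam.of L _ v (fun k => inclF φ n (w k)))
    (i : Q × Fin 3) (w : F) : ι (TreeAmalgam.periph L tauF.toMonoidHom i w) =
      TreeAmalgam.periph L (tauG hφ n) i (inclF φ n w) := by
  rw [TreeAmalgam.periph, MonoidHom.comp_apply, hι, TreeAmalgam.periph, MonoidHom.comp_apply,
    periph_comp (inclF_tauF hφ n)]
  rfl

/-- An action of `V_T` with free vertex groups extends to `W_T`. -/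
theorem exists_action_WT (hT : T.IsTree) {ι : VT L →* WT L hφ n} (hι : ∀ (v : Q) (w : Fin 3 → F),
      ι (TreeAmalgam.of L _ v w) = TreeAmalgam.of L _ v (fun k => inclF φ n (w k)))
    {Y : Type u} (α : VT L →* Perm Y) (hα : ∀ v x y, α (TreeAmalgam.of L _ v x) y = y → x = 1) :
    ∃ (X : Type u) (ρ : WT L hφ n →* Perm X) (j : Y → X), Function.Injective j ∧
      (∀ i, IsFreeExtension (inclF φ n) (ρ.comp (TreeAmalgam.periph L (tauG hφ n) i)) j) ∧
      ∀ g y, ρ (ι g) (j y) = j (α g y) := by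
  obtain ⟨ρ, j, hρ, hj⟩ := exists_treeAmalgam_extension hT L (inclF_injective n)
    (inclF_tauF hφ n) (tauG_tauG hφ n) α hα
  refine ⟨_, ρ, j, (hρ hT.connected.nonempty.some).injective,
    fun i => (hρ i.1).comp_periph _ i.2, fun g => ?_⟩
  have htop : equivariantSubgroup α (ρ.comp ι) j = ⊤ :=
    TreeAmalgam.subgroup_eq_top _ _ fun v w y => by
      rw [MonoidHom.comp_apply, hι]
      exact hj v w y
  exact htop.ge (Subgroup.mem_top g)

/-- The left translation action of `V_T` extends to `W_T`. The enumeration `ν` enters only through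
`S_{T,n}`, in which the vertex groups are known to embed. -/
theorem injective_of_map_of [Fintype Q] (hT : T.IsTree)
    (ν : Fin (Fintype.card Q + 2) ≃ {i : Q × Fin 3 // L.IsBoundary i})
    {ι : VT L →* WT L hφ n} (hι : ∀ (v : Q) (w : Fin 3 → F),
      ι (TreeAmalgam.of L _ v w) = TreeAmalgam.of L _ v (fun k => inclF φ n (w k))) :
    Function.Injective ι := by
  obtain ⟨X, ρ, j, hj, -, hρ⟩ := exists_action_WT hT hι (MulAction.toPermHom (VT L) (VT L))
    fun v x y hxy => vertexGroup_eq_one_of_map_eq_one hT L ν φ n v x (by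
      have : TreeAmalgam.of L tauF.toMonoidHom v x = 1 := mul_eq_right.1 hxy
      rw [this, map_one])
  refine (injective_iff_map_eq_one ι).2 fun g hg => ?_
  have := hρ g 1
  rw [hg, map_one, Perm.one_apply] at this
  simpa using (hj this).symm

theorem exists_hom_ST_GT [Fintype Q]
    (ν : Fin (Fintype.card Q + 2) ≃ {i : Q × Fin 3 // L.IsBoundary i})
    {ι : VT L →* WT L hφ n} (hι : ∀ (v : Q) (w : Fin 3 → F),
      ι (TreeAmalgam.of L _ v w) = TreeAmalgam.of L _ v (fun k => inclF φ n (w k))) :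
    ∃ Ψ : ST L ν φ n →* GT L ν hφ n,
      (∀ g : VT L, Ψ (MultiHNN.of _ _ g) = MultiHNN.of _ _ (ι g)) ∧
      ∀ i, Ψ (MultiHNN.stable _ _ i) = twistedStable L ν hφ n i := by
  refine MultiHNN.exists_lift ((MultiHNN.of _ _).comp ι) _ fun i w => ?_
  have h := MultiHNN.stable_conj_of (TreeAmalgam.periph L (tauG hφ n) (ν 0))
    (fun i : Fin (Fintype.card Q + 1) => TreeAmalgam.periph L (tauG hφ n) (ν i.succ)) i
    (inclF φ n w)
  rw [mul_inv_eq_iff_eq_mul] at h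
  simp only [MonoidHom.comp_apply, map_periph hι, twistedStable, MulEquiv.coe_toMonoidHom]
  rw [mul_assoc, h, ← mul_assoc, ← mul_assoc, ← map_mul, ← map_mul, ← map_mul, ← map_mul,
    genT_mul_inclF]

/-- The left translation action of `S_{T,n}` extends to `G_{T,n}`: first restrict it to `V_T` and
extend the restriction to `W_T`, then choose the stable letters so that `u_i` extends the
translation by `r_i`. -/
theorem injective_of_map_stable [Fintype Q] (hT : T.IsTree)
    (ν : Fin (Fintype.card Q + 2) ≃ {i : Q × Fin 3 // L.IsBoundary i})
    {ι : VT L →* WT L hφ n} (hι : ∀ (v : Q) (w : Fin 3 → F),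
      ι (TreeAmalgam.of L _ v w) = TreeAmalgam.of L _ v (fun k => inclF φ n (w k)))
    {Ψ : ST L ν φ n →* GT L ν hφ n}
    (hΨ : ∀ g : VT L, Ψ (MultiHNN.of _ _ g) = MultiHNN.of _ _ (ι g))
    (hΨ' : ∀ i, Ψ (MultiHNN.stable _ _ i) = twistedStable L ν hφ n i) :
    Function.Injective Ψ := by
  obtain ⟨X, ρ, j, hj, hext, hρ⟩ := exists_action_WT hT hι
    ((MulAction.toPermHom (ST L ν φ n) (ST L ν φ n)).comp (MultiHNN.of _ _))
    fun v x y hxy => vertexGroup_eq_one_of_map_eq_one hT L ν φ n v x (mul_eq_right.1 hxy)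
  have hρ₀ (g : VT L) (y : ST L ν φ n) : ρ (ι g) (j y) = j (MultiHNN.of _ _ g * y) := hρ g y
  -- The point `j y` has to be moved by `s_i = c⁻¹ u_i`, where `c` stands for `t`.
  obtain ⟨ρ', h1, h2⟩ := MultiHNN.exists_extension
    (β := fun i : Fin (Fintype.card Q + 1) => TreeAmalgam.periph L (tauG hφ n) (ν i.succ))
    (j' := fun i y => ρ (TreeAmalgam.periph L (tauG hφ n) (ν i.succ) (genT φ n)⁻¹)
      (j (MultiHNN.stable _ _ i * y)))
    ρ (hext (ν 0))
    (fun i => (hext (ν i.succ)).translate (inclF_range_normal n) (genT φ n)⁻¹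
      (Equiv.mulLeft (MultiHNN.stable _ _ i)))
    (fun w y => MultiHNN.of _ _ (TreeAmalgam.periph L tauF.toMonoidHom (ν 0) w) * y)
    (fun w y => by rw [← map_periph hι, hρ₀])
    (fun i w y => by
      have ht : inclF φ n w * (genT φ n)⁻¹ = (genT φ n)⁻¹ * inclF φ n ((φ ^ n) w) := by
        rw [eq_inv_mul_iff_mul_eq, ← mul_assoc, genT_mul_inclF, mul_inv_cancel_right]
      have hs := MultiHNN.stable_conj_of (TreeAmalgam.periph L tauF.toMonoidHom (ν 0))
        (fun i : Fin (Fintype.card Q + 1) =>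
          (TreeAmalgam.periph L tauF.toMonoidHom (ν i.succ)).comp (φ ^ n).toMonoidHom) i w
      rw [mul_inv_eq_iff_eq_mul] at hs
      rw [← Perm.mul_apply, ← map_mul, ← map_mul, ht, map_mul, map_mul, Perm.mul_apply,
        ← map_periph hι, hρ₀, ← mul_assoc, ← mul_assoc, hs]
      rfl)
  have htop : equivariantSubgroup (MulAction.toPermHom (ST L ν φ n) (ST L ν φ n))
      (ρ'.comp Ψ) j = ⊤ :=
    MultiHNN.subgroup_eq_top _ _ (fun g y => by
      rw [MonoidHom.comp_apply, hΨ, h1, hρ₀]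
      rfl) fun i y => by
      rw [MonoidHom.comp_apply, hΨ', twistedStable, map_mul, Perm.mul_apply, h1, h2,
        ← Perm.mul_apply, ← map_mul, ← map_mul, mul_inv_cancel, map_one, map_one, Perm.one_apply]
      rfl
  refine (injective_iff_map_eq_one Ψ).2 fun g hg => ?_
  have := htop.ge (Subgroup.mem_top g) (1 : ST L ν φ n)
  rw [MonoidHom.comp_apply, hg, map_one, Perm.one_apply] at this
  simpa using (hj this).symm

end

end Snowflake

theorem mainTheorem4 {Q : Type*} [Fintype Q] (T : SimpleGraph Q) (hT : T.IsTree)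
    (L : Snowflake.Labelling T)
    (ν : Fin (Fintype.card Q + 2) ≃ {i : Q × Fin 3 // L.IsBoundary i})
    (φ : MulAut Snowflake.F) (hφ : Snowflake.IsPalindromicAut φ) (n : ℕ) (hn : 1 ≤ n) :
    ∃! ι : Snowflake.VT L →* Snowflake.WT L hφ n,
      (∀ (v : Q) (w : Fin 3 → Snowflake.F),
        ι (Snowflake.TreeAmalgam.of L _ v w) =
          Snowflake.TreeAmalgam.of L _ v (fun k => Snowflake.inclF φ n (w k))) ∧
      Function.Injective ι ∧
      ∃! Ψ : Snowflake.ST L ν φ n →* Snowflake.GT L ν hφ n,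
        (∀ g : Snowflake.VT L,
          Ψ (Snowflake.MultiHNN.of _ _ g) = Snowflake.MultiHNN.of _ _ (ι g)) ∧
        (∀ i : Fin (Fintype.card Q + 1),
          Ψ (Snowflake.MultiHNN.stable _ _ i) = Snowflake.twistedStable L ν hφ n i) ∧
        Function.Injective Ψ := by
  obtain ⟨ι, hι⟩ := Snowflake.exists_hom_VT_WT L hφ n
  obtain ⟨Ψ, hΨ, hΨ'⟩ := Snowflake.exists_hom_ST_GT ν hι
  refine ⟨ι, ⟨hι, Snowflake.injective_of_map_of hT ν hι, Ψ, ⟨hΨ, hΨ',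
    Snowflake.injective_of_map_stable hT ν hι hΨ hΨ'⟩, fun Ψ' h => ?_⟩, fun ι' h => ?_⟩
  · refine MonoidHom.eq_of_eqOn_top fun x _ => ?_
    have htop : Ψ'.eqLocus Ψ = ⊤ := Snowflake.MultiHNN.subgroup_eq_top _ _
      (fun g => (h.1 g).trans (hΨ g).symm) fun i => (h.2.1 i).trans (hΨ' i).symm
    exact htop.ge (Subgroup.mem_top x)
  · refine MonoidHom.eq_of_eqOn_top fun x _ => ?_
    have htop : ι'.eqLocus ι = ⊤ := Snowflake.TreeAmalgam.subgroup_eq_top _ _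
      fun v w => (h.1 v w).trans (hι v w).symm
    exact htop.ge (Subgroup.mem_top x)
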